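/- Let $d,r\ge 1$, $\mathbb N=\{1,2,\dots\}$, let $|\cdot|$ denote the maximum norm on $\mathbb R^d$ and on $\mathbb N^r$, and let $(\Omega,\mathcal F,P)$ be a probability space. A (finite complex valued) transition measure $\nu$ is a map such that $\nu(\omega,\cdot)$ is a complex Borel measure on $\mathbb R^d$ for every $\omega\in\Omega$, $\nu(\cdot,B)$ is measurable for every Borel set $B$, and $E\,|\nu|(\cdot,\mathbb R^d)<\infty$, where $|\nu|(\omega,\cdot)$ is the variation of $\nu(\omega,\cdot)$; it is a probability transition measure if every $\nu(\omega,\cdot)$ is a probability measure. Put $E\nu(B)=\int_\Omega\nu(\omega,B)\,dP$, $E|\nu|(B)=\int_\Omega|\nu|(\omega,B)\,dP$, $\hat\nu^\omega(t)=\int e^{i\langle t,u\rangle}\,\nu(\omega,du)$, $\widehat{E\nu}(t)=\int e^{i\langle t,u\rangle}\,E\nu(du)$, and $\|\,|\nu|\,\|_\infty=\operatorname{ess\,sup}_\omega|\nu|(\omega,\mathbb R^d)\in[0,\infty]$. A family $\{\nu_k\}$ of transition measures is independent if, for any pairwise distinct indices $k_1,\dots,k_l$ and any Borel simple functions $g_1,\dots,g_l:\mathbb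 R^d\to\mathbb R$, the random variables $\int g_i\,d\nu_{k_i}(\omega,\cdot)$, $i=1,\dots,l$, are independent. There is a constant $c(d)>0$, depending only on $d$, such that the following holds. Let $\varphi:\mathbb R\to[0,\infty)$ be nondecreasing on $[0,\infty)$ with $\varphi(x)\ge c_0|x|$ for all $x$ and some $c_0>0$; let $\{\nu_k\}_{k\in\mathbb N^r}$ be independent transition measures, and let $a_k\in(0,1]$ for $k\in\mathbb N^r$. For integers $0\le n<m$ let $N_{n,m}=\{k\in\mathbb N^r: n<|k|\le m\}$. (1) If $\sum_{k\in\mathbb N^r} a_k\,E|\nu_k|(\{u:|u|>\varphi(|k|)\})<\infty$, then there is a measurable $C:\Omega\to(0,\infty)$ such that for $P$-almost every $\omega$, for all integers $0\le n<m$ and all real $T>2$, $$\max_{t\in[-T,T]^d}\Big|\sum_{k\in N_{n,m}}a_k\big(\hat\nu_k^\omega(t)-\widehat{E\nu_k}(t)\big)\Big|^2\le c(d)\,C(\omega)\Big(1+\sum_{k\in N_{n,m}}a_k^2\,\|\,|\nu_k|\,\|_\infty^2\,\log\max(\varphi(m),T)\Big).$$ (2) If the $\nu_k$ are probability transition measures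 and $\sum_{k\in\mathbb N^r}E\nu_k(\{u:|u|>\varphi(|k|)\})<\infty$, then there is a measurable $C:\Omega\to(0,\infty)$ such that for $P$-almost every $\omega$, for all integers $0\le n<m$ and all real $T>2$, $$\max_{t\in[-T,T]^d}\Big|\sum_{k\in N_{n,m}}a_k\big(\hat\nu_k^\omega(t)-\widehat{E\nu_k}(t)\big)\Big|^2\le c(d)\,C(\omega)\Big[\sum_{k\in N_{n,m}}a_k^2\Big]\log\max(\varphi(m),T).$$ -/

import Mathlib

open MeasureTheory ProbabilityTheory Set
open scoped ENNReal

noncomputable section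

/-- A finite complex valued transition measure `ν` on `Ω × E`, over the probability space `(Ω, P)`:
`ν(ω, ·)` is a complex measure on `E` for every `ω`, `ν(·, B)` is measurable for every measurable
`B`, and the total variation norm `|ν|(ω, E)` has finite expectation. -/
structure TransitionMeasure {Ω : Type*} [MeasurableSpace Ω] (P : Measure Ω)
    (E : Type*) [MeasurableSpace E] where
  /-- the complex measure `ν(ω, ·)` -/
  toFun : Ω → ComplexMeasure E
  measurable_apply : ∀ B : Set E, MeasurableSet B → Measurable fun ω => toFun ω B
  lintegral_variation_lt_top : ∫⁻ ω, (toFun ω).variation univ ∂P < ⊤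

namespace TransitionMeasure

variable {Ω : Type*} [MeasurableSpace Ω] {P : Measure Ω} {E : Type*} [MeasurableSpace E]

/-- The measure `Eν`, given by `Eν(B) = ∫ ν(ω, B) dP(ω)`. -/
def expectation (ν : TransitionMeasure P E) : ComplexMeasure E where
  measureOf' B := ∫ ω, ν.toFun ω B ∂P
  empty' := by simp
  not_measurable' B hB := by simp [VectorMeasure.not_measurable _ hB]
  m_iUnion' f hf hd := by
    have hsum : ∀ ω, HasSum (fun i => ν.toFun ω (f i)) (ν.toFun ω (⋃ i, f i)) :=
      fun ω => (ν.toFun ω).m_iUnion hf hd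
    have hfin : ∑' i, ∫⁻ ω, ‖ν.toFun ω (f i)‖ₑ ∂P ≠ ⊤ := by
      rw [← lintegral_tsum fun i => ((ν.measurable_apply _ (hf i)).enorm).aemeasurable]
      refine ne_top_of_le_ne_top ν.lintegral_variation_lt_top.ne (lintegral_mono fun ω => ?_)
      calc ∑' i, ‖ν.toFun ω (f i)‖ₑ
          ≤ ∑' i, (ν.toFun ω).variation (f i) :=
            ENNReal.tsum_le_tsum fun i => (ν.toFun ω).enorm_measure_le_variation _
        _ = (ν.toFun ω).variation (⋃ i, f i) := (measure_iUnion hd hf).symm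
        _ ≤ (ν.toFun ω).variation univ := measure_mono (subset_univ _)
    have hint := integral_tsum
      (fun i => (ν.measurable_apply _ (hf i)).aestronglyMeasurable (μ := P)) hfin
    have hi : ∀ i, ∫⁻ ω, ‖ν.toFun ω (f i)‖ₑ ∂P ≠ ⊤ := ENNReal.ne_top_of_tsum_ne_top hfin
    have hs : Summable fun i => ∫ ω, ν.toFun ω (f i) ∂P := by
      refine Summable.of_norm_bounded (ENNReal.summable_toReal hfin) fun i => ?_
      refine (norm_integral_le_lintegral_norm _).trans (le_of_eq ?_)
      simp only [ofReal_norm]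
    have h := hs.hasSum
    rw [← hint] at h
    simpa only [(hsum _).tsum_eq] using h

/-- `E|ν|(B)`, the expectation of the variation measure of `ν(ω, ·)` at `B`. -/
def expVariation (ν : TransitionMeasure P E) (B : Set E) : ℝ≥0∞ :=
  ∫⁻ ω, (ν.toFun ω).variation B ∂P

/-- `‖ |ν| ‖_{L^∞(Ω)}`, the essential supremum of the total variation `|ν|(ω, E)`
(possibly infinite). -/
def supVariation (ν : TransitionMeasure P E) : ℝ≥0∞ :=
  essSup (fun ω => (ν.toFun ω).variation univ) P

/-- `ν` is a probability transition measure: each `ν(ω, ·)` is a probability measure. -/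
def IsProbability (ν : TransitionMeasure P E) : Prop :=
  ∀ ω, ∃ μ : Measure E, IsProbabilityMeasure μ ∧
    ∀ B, MeasurableSet B → ν.toFun ω B = ((μ.real B : ℝ) : ℂ)

/-- Independence of a family of transition measures: for any choice of Borel simple functions
`g k`, the random variables `∫ g k(x) ν k(ω, dx)` are independent (which, by the definition of
`iIndepFun`, means that those with indices in any finite set are independent). -/
def Independent {ι : Type*} (ν : ι → TransitionMeasure P E) : Prop :=
  ∀ g : ι → SimpleFunc E ℝ,
    iIndepFun (fun k ω => ((ν k).toFun ω).integral (g k) (ContinuousLinearMap.lsmul ℝ ℝ)) P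

end TransitionMeasure

/-- The Fourier-Stieltjes transform `t ↦ ∫ exp(i⟨t,u⟩) μ(du)` of a complex measure on `ℝ^d`. -/
def fourierStieltjes {d : ℕ} (μ : ComplexMeasure (Fin d → ℝ)) (t : Fin d → ℝ) : ℂ :=
  μ.integral (fun u : Fin d → ℝ => Complex.exp (Complex.I * ((t ⬝ᵥ u : ℝ) : ℂ)))
    (ContinuousLinearMap.mul ℝ ℂ)

/-- `|k| = max_i k_i` for `k ∈ ℕ^r`, where `ℕ = {1, 2, …}`. -/
def maxNorm {r : ℕ} (k : Fin r → ℕ+) : ℕ := Finset.univ.sup fun i => (k i : ℕ)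

/-- `N_{n,m} = {k ∈ ℕ^r : n < |k| ≤ m}`. -/
def indexShell (r n m : ℕ) : Finset (Fin r → ℕ+) :=
  (Finset.Icc 1 fun _ => m.toPNat').filter fun k => n < maxNorm k ∧ maxNorm k ≤ m

theorem mem_indexShell {r n m : ℕ} {k : Fin r → ℕ+} :
    k ∈ indexShell r n m ↔ n < maxNorm k ∧ maxNorm k ≤ m := by
  simp only [indexShell, Finset.mem_filter, Finset.mem_Icc, and_iff_right_iff_imp]
  rintro ⟨h1, h2⟩
  refine ⟨fun i => one_le, fun i => ?_⟩
  have h3 : (k i : ℕ) ≤ maxNorm k := Finset.le_sup (f := fun i => (k i : ℕ)) (Finset.mem_univ i)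
  rw [← PNat.coe_le_coe, Nat.toPNat'_coe, if_pos (by omega)]
  omega

end

open Filter Topology

/-! ### Integration of bounded functions against complex measures. -/

section ComplexMeasureIntegral

variable {E : Type*} [MeasurableSpace E]

/-! Each `ν k` is cut at the ball `‖u‖ ≤ φ (maxNorm k)`. Outside the balls the expected variations
are summable with weights, so the tails of the transforms have a weighted sum that is almost surely
finite, uniformly in `t` (`exists_ae_sum_truncatedTransform_le`).

Inside, let `p ≥ 3` be an integer above `φ m` and `T`. The characters are `d * p`-Lipschitz in `t`
on the balls in question, so a grid of mesh `p ^ (-(r + 1))` replaces the cube up to an error `O(p ^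
(-r))` per index. There are `O(p ^ r)` indices, because `c₀ * m ≤ φ m ≤ p`, so the total error is
harmless. At a grid point the sum consists of independent, centred, bounded variables. By Hoeffding
its exponential moment at `s` is at most `exp (D * s ^ 2 / 2)`, with `D` bounding the sum of squares
(`lintegral_exp_sum_le`); `s = √(log p / D)` makes this at most `p`.

Only polynomially many triples (`n`, `m`, grid point) belong to a given `p`. Hence the exponentials,
weighted by a suitable negative power of `p`, have an integrable sum, and one random `W` bounds them
all by `p ^ q * W` (`exists_ae_forall_le_pow_mul`). Taking logarithms gives `(q + W) * √(D * log
p)`, simultaneously for all shells and all `T`.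

Independence is assumed only for integrals of real simple functions, so the truncated cosine and
sine at grid points are first replaced by simple functions. -/

instance ComplexMeasure.isFiniteMeasure_variation (μ : ComplexMeasure E) :
    IsFiniteMeasure μ.variation := by
  have h : μ.variation ≤ (ComplexMeasure.re μ).totalVariation +
      (ComplexMeasure.im μ).totalVariation := by
    refine VectorMeasure.variation_le_of_forall_enorm_le fun B hB => ?_
    rw [Measure.add_apply]
    refine le_trans ?_ (add_le_add (SignedMeasure.enorm_le_totalVariation _ B)
      (SignedMeasure.enorm_le_totalVariation _ B))
    have h1 : ComplexMeasure.re μ B = (μ B).re := rfl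
    have h2 : ComplexMeasure.im μ B = (μ B).im := rfl
    rw [h1, h2, ← ofReal_norm, ← ofReal_norm, ← ofReal_norm,
      ← ENNReal.ofReal_add (norm_nonneg _) (norm_nonneg _)]
    exact ENNReal.ofReal_le_ofReal (Complex.norm_le_abs_re_add_abs_im _)
  exact isFiniteMeasure_of_le _ h

theorem ComplexMeasure.integrable_of_norm_le (μ : ComplexMeasure E) {F : Type*}
    [NormedAddCommGroup F] {f : E → F} {C : ℝ} (hf : StronglyMeasurable f)
    (hC : ∀ u, ‖f u‖ ≤ C) : μ.Integrable f :=
  Integrable.of_bound hf.aestronglyMeasurable C (ae_of_all _ hC)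

theorem ComplexMeasure.integral_simpleFunc_lsmul (μ : ComplexMeasure E) (g : SimpleFunc E ℝ) :
    μ.integral g (ContinuousLinearMap.lsmul ℝ ℝ) = ∑ x ∈ g.range, (x : ℂ) * μ (g ⁻¹' {x}) := by
  rw [VectorMeasure.integral_eq_setToFun, setToFun_simpleFunc _ _ (g.integrable_of_isFiniteMeasure)]
  refine Finset.sum_congr rfl fun x _ => ?_
  rw [transpose_eq_cbmApplyMeasure, cbmApplyMeasure_apply]
  simp

theorem ComplexMeasure.integral_simpleFunc_mul (μ : ComplexMeasure E) (g : SimpleFunc E ℂ) :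
    μ.integral g (ContinuousLinearMap.mul ℝ ℂ) = ∑ x ∈ g.range, x * μ (g ⁻¹' {x}) := by
  rw [VectorMeasure.integral_eq_setToFun, setToFun_simpleFunc _ _ (g.integrable_of_isFiniteMeasure)]
  refine Finset.sum_congr rfl fun x _ => ?_
  rw [transpose_eq_cbmApplyMeasure, cbmApplyMeasure_apply]
  simp

theorem ComplexMeasure.integral_const_mul_simpleFunc (μ : ComplexMeasure E) (c : ℂ)
    (g : SimpleFunc E ℝ) :
    μ.integral (fun u => c * (g u : ℂ)) (ContinuousLinearMap.mul ℝ ℂ) =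
      c * μ.integral g (ContinuousLinearMap.lsmul ℝ ℝ) := by
  have h : (fun u => c * (g u : ℂ)) = (g.map fun x : ℝ => c * (x : ℂ) : E → ℂ) := rfl
  rw [h, VectorMeasure.integral_eq_setToFun, setToFun_simpleFunc_eq_setToSimpleFunc _ _
    (SimpleFunc.integrable_of_isFiniteMeasure _), SimpleFunc.map_setToSimpleFunc _ ?_
    (g.integrable_of_isFiniteMeasure (μ := μ.variation)) (by simp),
    ComplexMeasure.integral_simpleFunc_lsmul, Finset.mul_sum]
  · refine Finset.sum_congr rfl fun x _ => ?_
    rw [transpose_eq_cbmApplyMeasure, cbmApplyMeasure_apply]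
    simp [mul_assoc]
  · exact (dominatedFinMeasAdditive_cbmApplyMeasure μ _).1

theorem ComplexMeasure.enorm_integral_mul_le (μ : ComplexMeasure E) (f : E → ℂ) :
    ‖μ.integral f (ContinuousLinearMap.mul ℝ ℂ)‖ₑ ≤ ∫⁻ u, ‖f u‖ₑ ∂μ.variation := by
  refine VectorMeasure.enorm_integral_le_lintegral_enorm.trans ?_
  have : ‖ContinuousLinearMap.mul ℝ ℂ‖ₑ = 1 := by
    rw [← ofReal_norm, ContinuousLinearMap.opNorm_mul]; simp
  rw [this, one_mul]

theorem ComplexMeasure.norm_integral_lsmul_le (μ : ComplexMeasure E) {f : E → ℝ} {C : ℝ}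
    (hC : ∀ u, ‖f u‖ ≤ C) :
    ‖μ.integral f (ContinuousLinearMap.lsmul ℝ ℝ)‖ ≤ C * μ.variation.real univ := by
  have := VectorMeasure.norm_integral_le_of_norm_le_const
    (μ := μ) (B := ContinuousLinearMap.lsmul ℝ ℝ) (f := f) (C := C) (ae_of_all _ hC)
  rwa [ContinuousLinearMap.opNorm_lsmul, mul_one] at this

theorem ComplexMeasure.norm_integral_mul_le (μ : ComplexMeasure E) {f : E → ℂ} {C : ℝ}
    (hC : ∀ u, ‖f u‖ ≤ C) :
    ‖μ.integral f (ContinuousLinearMap.mul ℝ ℂ)‖ ≤ C * μ.variation.real univ := by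
  have := VectorMeasure.norm_integral_le_of_norm_le_const
    (μ := μ) (B := ContinuousLinearMap.mul ℝ ℂ) (f := f) (C := C) (ae_of_all _ hC)
  rwa [ContinuousLinearMap.opNorm_mul, mul_one] at this

/-- A bounded measurable function is a uniform limit of simple functions with the same bound. -/
theorem exists_simpleFunc_abs_sub_le {h : E → ℝ} (hm : Measurable h) (hb : ∀ u, |h u| ≤ 1)
    {N : ℕ} (hN : 0 < N) :
    ∃ g : SimpleFunc E ℝ, (∀ u, |g u| ≤ 1) ∧ ∀ u, |h u - g u| ≤ (N : ℝ)⁻¹ := by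
  have hN' : (0 : ℝ) < N := by exact_mod_cast hN
  have hlow : ∀ u, -(N : ℤ) ≤ ⌊h u * N⌋ := fun u => by
    rw [Int.le_floor]; push_cast
    nlinarith [(abs_le.1 (hb u)).1]
  have hupp : ∀ u, ⌊h u * N⌋ ≤ (N : ℤ) := fun u => by
    have : (⌊h u * N⌋ : ℝ) ≤ N := (Int.floor_le _).trans (by nlinarith [(abs_le.1 (hb u)).2])
    exact_mod_cast this
  -- Round down to multiples of `1 / N`; since `±1` are such multiples, the bound survives and the
  -- range is finite.
  refine ⟨⟨fun u => (⌊h u * N⌋ : ℝ) / N, fun x => ?_, ?_⟩, fun u => ?_, fun u => ?_⟩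
  · have : Measurable fun u => (⌊h u * N⌋ : ℝ) / N :=
      (measurable_from_top.comp (Int.measurable_floor.comp (hm.mul_const _))).div_const _
    exact this (measurableSet_singleton x)
  · refine ((Set.finite_Icc (-(N : ℤ)) N).image fun z : ℤ => (z : ℝ) / N).subset ?_
    rintro _ ⟨u, rfl⟩
    exact ⟨_, ⟨hlow u, hupp u⟩, rfl⟩
  · change |(⌊h u * N⌋ : ℝ) / N| ≤ 1
    rw [abs_le, le_div_iff₀ hN', div_le_iff₀ hN']
    have h1 : ((-(N : ℤ) : ℤ) : ℝ) ≤ ⌊h u * N⌋ := by exact_mod_cast hlow u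
    have h2 : (⌊h u * N⌋ : ℝ) ≤ ((N : ℤ) : ℝ) := by exact_mod_cast hupp u
    push_cast at h1 h2
    constructor <;> linarith
  · change |h u - (⌊h u * N⌋ : ℝ) / N| ≤ (N : ℝ)⁻¹
    have h1 := Int.floor_le (h u * N)
    have h2 := Int.lt_floor_add_one (h u * N)
    have h3 : h u - (⌊h u * N⌋ : ℝ) / N = (h u * N - ⌊h u * N⌋) * (N : ℝ)⁻¹ := by
      field_simp
    rw [h3, abs_mul, abs_of_nonneg (by linarith), abs_of_pos (inv_pos.2 hN')]
    exact mul_le_of_le_one_left (inv_pos.2 hN').le (by linarith)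

end ComplexMeasureIntegral

/-! ### Measurability in `ω` and comparison with the expectation. -/

namespace TransitionMeasure

variable {Ω : Type*} [MeasurableSpace Ω] {P : Measure Ω} {E : Type*} [MeasurableSpace E]

theorem measurable_integral_simpleFunc (ν : TransitionMeasure P E) (g : SimpleFunc E ℝ) :
    Measurable fun ω => (ν.toFun ω).integral g (ContinuousLinearMap.lsmul ℝ ℝ) := by
  simp_rw [ComplexMeasure.integral_simpleFunc_lsmul]
  exact Finset.measurable_sum _ fun x _ =>
    (ν.measurable_apply _ (g.measurableSet_fiber x)).const_mul _

theorem integrable_apply (ν : TransitionMeasure P E) {B : Set E} (hB : MeasurableSet B) :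
    Integrable (fun ω => ν.toFun ω B) P := by
  refine ⟨(ν.measurable_apply B hB).aestronglyMeasurable, ?_⟩
  refine lt_of_le_of_lt (lintegral_mono fun ω => ?_) ν.lintegral_variation_lt_top
  exact ((ν.toFun ω).enorm_measure_le_variation B).trans (measure_mono (subset_univ _))

theorem integral_integral_simpleFunc (ν : TransitionMeasure P E) (g : SimpleFunc E ℝ) :
    ∫ ω, (ν.toFun ω).integral g (ContinuousLinearMap.lsmul ℝ ℝ) ∂P =
      ν.expectation.integral g (ContinuousLinearMap.lsmul ℝ ℝ) := by
  simp_rw [ComplexMeasure.integral_simpleFunc_lsmul]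
  rw [integral_finsetSum _ fun x _ =>
    (ν.integrable_apply (g.measurableSet_fiber x)).const_mul _]
  refine Finset.sum_congr rfl fun x _ => ?_
  rw [integral_const_mul]
  rfl

/-- A finite partition nearly attaining the variation of the mean can be tested inside the
expectation, where it is dominated by the variation for each `ω`. -/
theorem variation_expectation_le (ν : TransitionMeasure P E) {B : Set E} (hB : MeasurableSet B) :
    ν.expectation.variation B ≤ ν.expVariation B := by
  refine le_of_forall_lt_imp_le_of_dense fun c hc => ?_
  obtain ⟨Q, hQ1, hQ2, hQ3, hQ4⟩ := ν.expectation.exists_lt_sum_of_lt_variation hB hc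
  refine hQ4.le.trans ?_
  calc ∑ q ∈ Q, ‖ν.expectation q‖ₑ
      ≤ ∑ q ∈ Q, ∫⁻ ω, ‖ν.toFun ω q‖ₑ ∂P :=
        Finset.sum_le_sum fun q _ => enorm_integral_le_lintegral_enorm _
    _ = ∫⁻ ω, ∑ q ∈ Q, ‖ν.toFun ω q‖ₑ ∂P :=
        (lintegral_finsetSum' _ fun q hq =>
          (ν.measurable_apply q (hQ3 q hq)).enorm.aemeasurable).symm
    _ ≤ ν.expVariation B := lintegral_mono fun ω => (ν.toFun ω).le_variation hB hQ1 hQ2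

theorem measurable_integral_of_norm_le (ν : TransitionMeasure P E) {f : E → ℂ} {C : ℝ}
    (hf : StronglyMeasurable f) (hC : ∀ u, ‖f u‖ ≤ C) :
    Measurable fun ω => (ν.toFun ω).integral f (ContinuousLinearMap.mul ℝ ℂ) := by
  have hsimple : ∀ g : SimpleFunc E ℂ,
      Measurable fun ω => (ν.toFun ω).integral g (ContinuousLinearMap.mul ℝ ℂ) := fun g => by
    simp_rw [ComplexMeasure.integral_simpleFunc_mul]
    exact Finset.measurable_sum _ fun x _ =>
      (ν.measurable_apply _ (g.measurableSet_fiber x)).const_mul _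
  refine measurable_of_tendsto_metrizable
    (fun n => hsimple (hf.approxBounded C n)) (tendsto_pi_nhds.2 fun ω => ?_)
  refine VectorMeasure.tendsto_integral_filter_of_norm_le_const
    (Eventually.of_forall fun n => (hf.approxBounded C n).aestronglyMeasurable)
    ⟨C, Eventually.of_forall fun n => ae_of_all _ fun u =>
      hf.norm_approxBounded_le ?_ n u⟩
    (ae_of_all _ fun u => hf.tendsto_approxBounded_of_norm_le (hC u))
  exact (norm_nonneg _).trans (hC u)

theorem variation_univ_le_one {ν : TransitionMeasure P E} (hν : ν.IsProbability) (ω : Ω) :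
    (ν.toFun ω).variation univ ≤ 1 := by
  obtain ⟨μ, hμ, h⟩ := hν ω
  refine le_trans (VectorMeasure.variation_le_of_forall_enorm_le (m := μ) (fun B hB => ?_) univ)
    prob_le_one
  rw [h B hB, ← ofReal_norm, Complex.norm_real, Real.norm_of_nonneg measureReal_nonneg,
    ofReal_measureReal]

end TransitionMeasure

/-! ### Transforms restricted to a set, and their approximation by simple functions. -/

section TruncatedTransform

variable {d : ℕ}

/-- The Fourier-Stieltjes transform of the restriction of `μ` to `B`. -/
noncomputable def truncatedTransform (B : Set (Fin d → ℝ)) (μ : ComplexMeasure (Fin d → ℝ))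
    (t : Fin d → ℝ) : ℂ :=
  μ.integral (B.indicator fun u => Complex.exp (Complex.I * ((t ⬝ᵥ u : ℝ) : ℂ)))
    (ContinuousLinearMap.mul ℝ ℂ)

theorem continuous_character :
    Continuous fun p : (Fin d → ℝ) × (Fin d → ℝ) =>
      Complex.exp (Complex.I * ((p.1 ⬝ᵥ p.2 : ℝ) : ℂ)) := by
  unfold dotProduct
  fun_prop

theorem norm_character (x : ℝ) : ‖Complex.exp (Complex.I * (x : ℂ))‖ = 1 :=
  Complex.norm_exp_I_mul_ofReal x

theorem norm_indicator_character_le (B : Set (Fin d → ℝ)) (t u : Fin d → ℝ) :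
    ‖B.indicator (fun u => Complex.exp (Complex.I * ((t ⬝ᵥ u : ℝ) : ℂ))) u‖ ≤ 1 :=
  (norm_indicator_le_norm_self _ _).trans (norm_character _).le

theorem stronglyMeasurable_indicator_character {B : Set (Fin d → ℝ)} (hB : MeasurableSet B)
    (t : Fin d → ℝ) : StronglyMeasurable
      (B.indicator fun u => Complex.exp (Complex.I * ((t ⬝ᵥ u : ℝ) : ℂ))) :=
  ((continuous_character.comp (Continuous.prodMk_right t)).stronglyMeasurable).indicator hB

theorem fourierStieltjes_eq_add {B : Set (Fin d → ℝ)} (hB : MeasurableSet B)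
    (μ : ComplexMeasure (Fin d → ℝ)) (t : Fin d → ℝ) :
    fourierStieltjes μ t = truncatedTransform B μ t + truncatedTransform Bᶜ μ t := by
  have hint : ∀ A : Set (Fin d → ℝ), MeasurableSet A → μ.Integrable
      (A.indicator fun u => Complex.exp (Complex.I * ((t ⬝ᵥ u : ℝ) : ℂ))) := fun A hA =>
    ComplexMeasure.integrable_of_norm_le μ (stronglyMeasurable_indicator_character hA t)
      (norm_indicator_character_le A t)
  rw [truncatedTransform, truncatedTransform,
    ← VectorMeasure.integral_add (hint B hB) (hint Bᶜ hB.compl), indicator_self_add_compl]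
  rfl

theorem enorm_truncatedTransform_le {B : Set (Fin d → ℝ)} (hB : MeasurableSet B)
    (μ : ComplexMeasure (Fin d → ℝ)) (t : Fin d → ℝ) :
    ‖truncatedTransform B μ t‖ₑ ≤ μ.variation B := by
  refine (ComplexMeasure.enorm_integral_mul_le μ _).trans ?_
  rw [← lintegral_indicator_one hB]
  refine lintegral_mono fun u => ?_
  rw [enorm_indicator_eq_indicator_enorm]
  refine indicator_le_indicator ?_
  rw [← ofReal_norm, norm_character]
  simp

theorem continuous_truncatedTransform {B : Set (Fin d → ℝ)} (hB : MeasurableSet B)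
    (μ : ComplexMeasure (Fin d → ℝ)) : Continuous (truncatedTransform B μ) := by
  refine VectorMeasure.continuous_of_dominated (bound := fun _ => 1)
    (fun t => (stronglyMeasurable_indicator_character hB t).aestronglyMeasurable)
    (fun t => ae_of_all _ (norm_indicator_character_le B t)) (integrable_const _)
    (ae_of_all _ fun u => ?_)
  by_cases hu : u ∈ B
  · simp only [indicator_of_mem hu]
    exact continuous_character.comp (Continuous.prodMk_left u)
  · simpa only [indicator_of_notMem hu] using continuous_const

/-- The truncated transforms of a transition measure are dominated, uniformly in `t`, by a
measurable function whose mean is at most the expected variation. -/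
theorem TransitionMeasure.exists_measurable_bound {Ω : Type*} [MeasurableSpace Ω] {P : Measure Ω}
    (ν : TransitionMeasure P (Fin d → ℝ)) {B : Set (Fin d → ℝ)} (hB : MeasurableSet B) :
    ∃ f : Ω → ℝ≥0∞, Measurable f ∧ (∀ ω t, ‖truncatedTransform B (ν.toFun ω) t‖ₑ ≤ f ω) ∧
      ∫⁻ ω, f ω ∂P ≤ ν.expVariation B := by
  -- A countable supremum is measurable and, by continuity in `t`, controls every `t`. This avoids
  -- any measurability of `ω ↦ |ν|(ω, B)`.
  refine ⟨fun ω => ⨆ n, ‖truncatedTransform B (ν.toFun ω) (TopologicalSpace.denseSeq _ n)‖ₑ,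
    Measurable.iSup fun n => (ν.measurable_integral_of_norm_le
      (stronglyMeasurable_indicator_character hB _) (norm_indicator_character_le B _)).enorm,
    fun ω t => ?_, lintegral_mono fun ω => iSup_le fun n => enorm_truncatedTransform_le hB _ _⟩
  have hclosed : IsClosed {t | ‖truncatedTransform B (ν.toFun ω) t‖ₑ ≤
      ⨆ n, ‖truncatedTransform B (ν.toFun ω) (TopologicalSpace.denseSeq _ n)‖ₑ} :=
    isClosed_le (continuous_truncatedTransform hB _).enorm continuous_const
  refine hclosed.closure_subset_iff.2 ?_ (TopologicalSpace.denseRange_denseSeq (Fin d → ℝ) t)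
  rintro _ ⟨n, rfl⟩
  exact le_iSup (fun n => ‖truncatedTransform B (ν.toFun ω) (TopologicalSpace.denseSeq _ n)‖ₑ) n

theorem norm_character_sub_le (x y : ℝ) :
    ‖Complex.exp (Complex.I * (x : ℂ)) - Complex.exp (Complex.I * (y : ℂ))‖ ≤ |x - y| := by
  have h : Complex.exp (Complex.I * (x : ℂ)) - Complex.exp (Complex.I * (y : ℂ)) =
      Complex.exp (Complex.I * (y : ℂ)) *
        (Complex.exp (Complex.I * ((x - y : ℝ) : ℂ)) - 1) := by
    rw [mul_sub, ← Complex.exp_add]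
    push_cast
    ring_nf
  rw [h, norm_mul, norm_character, one_mul]
  exact Real.norm_exp_I_mul_ofReal_sub_one_le

theorem abs_dotProduct_sub_le {t s u : Fin d → ℝ} {δ ρ : ℝ} (hδ : 0 ≤ δ)
    (ht : ∀ i, |t i - s i| ≤ δ) (hu : ‖u‖ ≤ ρ) : |t ⬝ᵥ u - s ⬝ᵥ u| ≤ d * (δ * ρ) := by
  rw [← sub_dotProduct]
  refine (Finset.abs_sum_le_sum_abs _ _).trans ?_
  refine (Finset.sum_le_card_nsmul _ _ (δ * ρ) fun i _ => ?_).trans (by simp)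
  rw [abs_mul]
  exact mul_le_mul (ht i) ((norm_le_pi_norm u i).trans hu) (abs_nonneg _) hδ

/-- On the ball, moving the frequency from `t` to `s` changes the character by at most `d * (δ *
ρ)`; the approximations of cosine and sine cost `ε` each. Integrating this uniform error against the
variation gives the bound. -/
theorem norm_truncatedTransform_sub_le {ρ δ ε : ℝ} (μ : ComplexMeasure (Fin d → ℝ))
    {t s : Fin d → ℝ} (hδ : 0 ≤ δ) (hρ : 0 ≤ ρ) (ht : ∀ i, |t i - s i| ≤ δ)
    {f g : SimpleFunc (Fin d → ℝ) ℝ}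
    (hf : ∀ u, |{u : Fin d → ℝ | ‖u‖ ≤ ρ}.indicator (fun u => Real.cos (s ⬝ᵥ u)) u - f u| ≤ ε)
    (hg : ∀ u, |{u : Fin d → ℝ | ‖u‖ ≤ ρ}.indicator (fun u => Real.sin (s ⬝ᵥ u)) u - g u| ≤ ε) :
    ‖truncatedTransform {u | ‖u‖ ≤ ρ} μ t -
      (μ.integral f (ContinuousLinearMap.lsmul ℝ ℝ) +
        Complex.I * μ.integral g (ContinuousLinearMap.lsmul ℝ ℝ))‖ ≤
      (d * (δ * ρ) + 2 * ε) * μ.variation.real univ := by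
  have hB : MeasurableSet {u : Fin d → ℝ | ‖u‖ ≤ ρ} := measurableSet_le measurable_norm measurable_const
  have hint : ∀ (c : ℂ) (g : SimpleFunc (Fin d → ℝ) ℝ), μ.Integrable fun u => c * (g u : ℂ) :=
    fun c g => (g.map fun x : ℝ => c * (x : ℂ)).integrable_of_isFiniteMeasure
  have h1 : μ.integral f (ContinuousLinearMap.lsmul ℝ ℝ) +
      Complex.I * μ.integral g (ContinuousLinearMap.lsmul ℝ ℝ) =
      μ.integral (fun u => (1 : ℂ) * (f u : ℂ) + Complex.I * (g u : ℂ))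
        (ContinuousLinearMap.mul ℝ ℂ) := by
    rw [VectorMeasure.integral_fun_add (hint _ _) (hint _ _), ComplexMeasure.integral_const_mul_simpleFunc μ,
      ComplexMeasure.integral_const_mul_simpleFunc μ, one_mul]
  rw [h1, truncatedTransform, ← VectorMeasure.integral_sub
    (ComplexMeasure.integrable_of_norm_le μ (stronglyMeasurable_indicator_character hB t)
      (norm_indicator_character_le _ t))
    (g := fun u => (1 : ℂ) * (f u : ℂ) + Complex.I * (g u : ℂ)) ((hint _ _).add (hint _ _))]
  refine ComplexMeasure.norm_integral_mul_le μ fun u => ?_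
  simp only [Pi.sub_apply, one_mul]
  have key : ∀ (z : ℂ) (x y : ℝ), |x - f u| ≤ ε → |y - g u| ≤ ε →
      ‖z - (x + Complex.I * y)‖ ≤ d * (δ * ρ) →
      ‖z - (f u + Complex.I * g u)‖ ≤ d * (δ * ρ) + 2 * ε := fun z x y hx hy hz => by
    have h2 : z - (f u + Complex.I * g u) = (z - (x + Complex.I * y)) +
        (((x - f u : ℝ) : ℂ) + Complex.I * ((y - g u : ℝ) : ℂ)) := by push_cast; ring
    rw [h2]
    refine (norm_add_le _ _).trans (add_le_add hz ((norm_add_le _ _).trans ?_))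
    rw [norm_mul, Complex.norm_I, one_mul, Complex.norm_real, Complex.norm_real]
    simpa only [Real.norm_eq_abs, two_mul] using add_le_add hx hy
  refine key _ _ _ (hf u) (hg u) ?_
  by_cases hu : u ∈ {u : Fin d → ℝ | ‖u‖ ≤ ρ}
  · simp only [indicator_of_mem hu]
    have h3 : ((Real.cos (s ⬝ᵥ u) : ℝ) : ℂ) + Complex.I * ((Real.sin (s ⬝ᵥ u) : ℝ) : ℂ) =
        Complex.exp (Complex.I * ((s ⬝ᵥ u : ℝ) : ℂ)) := by
      rw [mul_comm Complex.I ((s ⬝ᵥ u : ℝ) : ℂ), Complex.exp_mul_I]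
      push_cast; ring
    rw [h3]
    exact (norm_character_sub_le _ _).trans (abs_dotProduct_sub_le hδ ht hu)
  · simp only [indicator_of_notMem hu]
    simp only [Complex.ofReal_zero, mul_zero, add_zero, sub_zero, norm_zero]
    positivity

end TruncatedTransform

/-! ### Exponential moments of independent sums. -/

namespace TransitionMeasure

variable {Ω : Type*} [MeasurableSpace Ω] {P : Measure Ω} {E : Type*} [MeasurableSpace E]

theorem variation_real_le {μ : ComplexMeasure E} {b : ℝ} (hb : 0 ≤ b)
    (h : μ.variation univ ≤ ENNReal.ofReal b) : μ.variation.real univ ≤ b :=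
  ENNReal.toReal_le_of_le_ofReal hb h

theorem variation_expectation_univ_le [IsProbabilityMeasure P] (ν : TransitionMeasure P E) {b : ℝ}
    (h : ∀ᵐ ω ∂P, (ν.toFun ω).variation univ ≤ ENNReal.ofReal b) :
    ν.expectation.variation univ ≤ ENNReal.ofReal b :=
  (ν.variation_expectation_le MeasurableSet.univ).trans
    ((lintegral_mono_ae h).trans (by simp))

/-- Hoeffding's bound for the exponential moments of a weighted sum of centred integrals of simple
functions against independent transition measures. -/
theorem lintegral_exp_sum_le [IsProbabilityMeasure P] {ι : Type*} {ν : ι → TransitionMeasure P E}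
    (hν : Independent ν) (F : Finset ι) {a b : ι → ℝ} (ha : ∀ k, 0 ≤ a k) (hb : ∀ k, 0 ≤ b k)
    (hbν : ∀ k ∈ F, ∀ᵐ ω ∂P, ((ν k).toFun ω).variation univ ≤ ENNReal.ofReal (b k))
    {g : ι → SimpleFunc E ℝ} (hg : ∀ k u, |g k u| ≤ 1) {L : ℂ →L[ℝ] ℝ} (hL : ∀ z, |L z| ≤ ‖z‖)
    {D : ℝ} (hD : ∑ k ∈ F, (a k * b k) ^ 2 ≤ D) (s : ℝ) :
    ∫⁻ ω, ENNReal.ofReal (Real.exp (s * ∑ k ∈ F,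
        a k * L (((ν k).toFun ω).integral (g k) (ContinuousLinearMap.lsmul ℝ ℝ) -
          (ν k).expectation.integral (g k) (ContinuousLinearMap.lsmul ℝ ℝ)))) ∂P ≤
      ENNReal.ofReal (Real.exp (D * s ^ 2 / 2)) := by
  set X : ι → Ω → ℝ := fun k ω =>
    a k * L (((ν k).toFun ω).integral (g k) (ContinuousLinearMap.lsmul ℝ ℝ)) with hX
  set e : ι → ℝ := fun k =>
    a k * L ((ν k).expectation.integral (g k) (ContinuousLinearMap.lsmul ℝ ℝ)) with he
  have hmeas : ∀ k, Measurable fun ω =>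
      ((ν k).toFun ω).integral (g k) (ContinuousLinearMap.lsmul ℝ ℝ) :=
    fun k => (ν k).measurable_integral_simpleFunc (g k)
  have hXm : ∀ k, Measurable (X k) := fun k => (L.measurable.comp (hmeas k)).const_mul _
  have hnorm : ∀ k ∈ F, ∀ᵐ ω ∂P,
      ‖((ν k).toFun ω).integral (g k) (ContinuousLinearMap.lsmul ℝ ℝ)‖ ≤ b k := fun k hk => by
    filter_upwards [hbν k hk] with ω hω
    refine (ComplexMeasure.norm_integral_lsmul_le _ (C := 1) (hg k)).trans ?_
    rw [one_mul]
    exact variation_real_le (hb k) hω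
  have hmean : ∀ k ∈ F, ∫ ω, X k ω ∂P = e k := fun k hk => by
    have hint : Integrable (fun ω =>
        ((ν k).toFun ω).integral (g k) (ContinuousLinearMap.lsmul ℝ ℝ)) P :=
      Integrable.of_bound (hmeas k).aestronglyMeasurable _ (hnorm k hk)
    rw [hX, he]
    simp only
    rw [integral_const_mul, L.integral_comp_comm hint, integral_integral_simpleFunc]
  have hindep : iIndepFun (fun k ω => X k ω - e k) P :=
    (hν g).comp (fun k z => a k * L z - e k)
      (fun k => (L.measurable.const_mul _).sub_const _)
  -- Hoeffding's lemma on `[-(a k * b k), a k * b k]`: half the length squared is the variance proxy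
  -- `(a k * b k) ^ 2`.
  have hsub : ∀ k ∈ F, HasSubgaussianMGF (fun ω => X k ω - e k)
      ((‖a k * b k - -(a k * b k)‖₊ / 2) ^ 2) P := fun k hk => by
    have := hasSubgaussianMGF_of_mem_Icc (μ := P) (X := X k) (a := -(a k * b k)) (b := a k * b k)
      (hXm k).aemeasurable ?_
    · rwa [hmean k hk] at this
    · filter_upwards [hnorm k hk] with ω hω
      rw [mem_Icc, ← abs_le, hX, abs_mul, abs_of_nonneg (ha k)]
      exact mul_le_mul_of_nonneg_left ((hL _).trans hω) (ha k)
  have hsum := HasSubgaussianMGF.sum_of_iIndepFun hindep hsub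
  have hsumeq : ∀ ω, (∑ k ∈ F, a k * L (((ν k).toFun ω).integral (g k)
      (ContinuousLinearMap.lsmul ℝ ℝ) -
        (ν k).expectation.integral (g k) (ContinuousLinearMap.lsmul ℝ ℝ))) =
      ∑ k ∈ F, (X k ω - e k) := fun ω =>
    Finset.sum_congr rfl fun k _ => by rw [map_sub, mul_sub]
  simp_rw [hsumeq]
  rw [← ofReal_integral_eq_lintegral_ofReal (hsum.integrable_exp_mul s)
    (ae_of_all _ fun ω => (Real.exp_pos _).le)]
  refine ENNReal.ofReal_le_ofReal ((hsum.mgf_le s).trans (Real.exp_le_exp.2 ?_))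
  have hc : ((∑ k ∈ F, (‖a k * b k - -(a k * b k)‖₊ / 2) ^ 2 : NNReal) : ℝ) ≤ D := by
    push_cast
    refine le_trans (le_of_eq (Finset.sum_congr rfl fun k _ => ?_)) hD
    rw [Real.norm_eq_abs, div_pow, sq_abs]
    ring
  have := mul_le_mul_of_nonneg_right hc (sq_nonneg s)
  linarith

end TransitionMeasure

/-- Nonnegative random variables indexed by polynomially growing finite sets, with means of
polynomial growth, are almost surely all of polynomial growth. -/
theorem exists_ae_forall_le_pow_mul {Ω : Type*} [MeasurableSpace Ω] {P : Measure Ω} {J : Type*}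
    {V : ℕ → J → Ω → ℝ≥0∞} (hV : ∀ p j, Measurable (V p j)) {S : ℕ → Finset J} {K e c : ℕ}
    (hS : ∀ p, 1 ≤ p → (S p).card ≤ K * p ^ e)
    (hE : ∀ p, 1 ≤ p → ∀ j ∈ S p, ∫⁻ ω, V p j ω ∂P ≤ (p : ℝ≥0∞) ^ c) :
    ∃ W : Ω → ℝ, Measurable W ∧ (∀ ω, 0 ≤ W ω) ∧ ∀ᵐ ω ∂P, ∀ p, 1 ≤ p → ∀ j ∈ S p,
      V p j ω ≤ ENNReal.ofReal ((p : ℝ) ^ (e + c + 2) * W ω) := by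
  -- At level `p` there are at most `K * p ^ e` terms of mean at most `p ^ c`, so this weight leaves
  -- `K / p ^ 2`, which is summable. Each single term is at most `U`.
  set U : Ω → ℝ≥0∞ := fun ω => ∑' p : ℕ, ∑ j ∈ S (p + 1),
    (((p + 1 : ℕ) : ℝ≥0∞) ^ (e + c + 2))⁻¹ * V (p + 1) j ω with hU
  have hUm : Measurable U := Measurable.tsum fun p =>
    Finset.measurable_fun_sum _ fun j _ => (hV _ _).const_mul _
  have hUint : ∫⁻ ω, U ω ∂P ≠ ⊤ := by
    have hle : ∫⁻ ω, U ω ∂P ≤ ∑' p : ℕ, (K : ℝ≥0∞) * ENNReal.ofReal (1 / ((p : ℝ) + 1) ^ 2) := by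
      rw [lintegral_tsum fun p => (Finset.measurable_fun_sum _ fun j _ =>
        (hV _ _).const_mul _).aemeasurable]
      refine ENNReal.tsum_le_tsum fun p => ?_
      rw [lintegral_finsetSum _ fun j _ => (hV _ _).const_mul _]
      have hp0 : ((p + 1 : ℕ) : ℝ≥0∞) ≠ 0 := by simp
      have hpt : ((p + 1 : ℕ) : ℝ≥0∞) ≠ ⊤ := ENNReal.natCast_ne_top _
      have hterm : ∀ j ∈ S (p + 1), ∫⁻ ω, (((p + 1 : ℕ) : ℝ≥0∞) ^ (e + c + 2))⁻¹ *
          V (p + 1) j ω ∂P ≤ (((p + 1 : ℕ) : ℝ≥0∞) ^ (e + c + 2))⁻¹ *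
            ((p + 1 : ℕ) : ℝ≥0∞) ^ c := fun j hj => by
        rw [lintegral_const_mul _ (hV _ _)]
        exact mul_le_mul_right (hE _ (by omega) j hj) _
      refine (Finset.sum_le_card_nsmul _ _ _ hterm).trans ?_
      rw [nsmul_eq_mul]
      have hcard : ((S (p + 1)).card : ℝ≥0∞) ≤ (K : ℝ≥0∞) * ((p + 1 : ℕ) : ℝ≥0∞) ^ e := by
        exact_mod_cast hS (p + 1) (by omega)
      refine (mul_le_mul_left hcard _).trans (le_of_eq ?_)
      have h1 : ENNReal.ofReal (1 / ((p : ℝ) + 1) ^ 2) = (((p + 1 : ℕ) : ℝ≥0∞) ^ 2)⁻¹ := by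
        rw [one_div, ENNReal.ofReal_inv_of_pos (by positivity),
          ENNReal.ofReal_pow (by positivity)]
        congr 2
        rw [← ENNReal.ofReal_natCast]
        push_cast
        rfl
      rw [h1, mul_assoc]
      congr 1
      rw [pow_add, pow_add, ENNReal.mul_inv (Or.inr (ENNReal.pow_ne_top hpt))
        (Or.inr (pow_ne_zero _ hp0)), mul_comm _ (((p + 1 : ℕ) : ℝ≥0∞) ^ c),
        ← mul_assoc, ← mul_assoc, ENNReal.mul_inv_cancel
          (mul_ne_zero (pow_ne_zero _ hp0) (pow_ne_zero _ hp0))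
          (ENNReal.mul_ne_top (ENNReal.pow_ne_top hpt) (ENNReal.pow_ne_top hpt)), one_mul]
    refine ne_top_of_le_ne_top ?_ hle
    rw [ENNReal.tsum_mul_left]
    have hs : Summable fun p : ℕ => 1 / ((p : ℝ) + 1) ^ 2 := by
      have := (summable_nat_add_iff 1).2 (Real.summable_one_div_nat_pow.2 one_lt_two)
      simpa using this
    exact ENNReal.mul_ne_top (ENNReal.natCast_ne_top _) hs.tsum_ofReal_ne_top
  refine ⟨fun ω => (U ω).toReal, hUm.ennreal_toReal, fun ω => ENNReal.toReal_nonneg, ?_⟩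
  filter_upwards [ae_lt_top hUm hUint] with ω hω p hp j hj
  obtain ⟨p, rfl⟩ := Nat.exists_eq_add_of_le' hp
  have hp0 : ((p + 1 : ℕ) : ℝ≥0∞) ≠ 0 := by simp
  have hpt : ((p + 1 : ℕ) : ℝ≥0∞) ≠ ⊤ := ENNReal.natCast_ne_top _
  rw [ENNReal.ofReal_mul (by positivity), ENNReal.ofReal_toReal hω.ne,
    ENNReal.ofReal_pow (by positivity), ENNReal.ofReal_natCast]
  have h1 : (((p + 1 : ℕ) : ℝ≥0∞) ^ (e + c + 2))⁻¹ * V (p + 1) j ω ≤ U ω :=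
    (Finset.single_le_sum (f := fun j => (((p + 1 : ℕ) : ℝ≥0∞) ^ (e + c + 2))⁻¹ *
      V (p + 1) j ω) (fun _ _ => zero_le) hj).trans
      (ENNReal.le_tsum (f := fun p : ℕ => ∑ j ∈ S (p + 1),
        (((p + 1 : ℕ) : ℝ≥0∞) ^ (e + c + 2))⁻¹ * V (p + 1) j ω) p)
  refine le_trans (le_of_eq ?_) (mul_le_mul_right h1 (((p + 1 : ℕ) : ℝ≥0∞) ^ (e + c + 2)))
  rw [← mul_assoc, ENNReal.mul_inv_cancel (pow_ne_zero _ hp0) (ENNReal.pow_ne_top hpt), one_mul]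

/-! ### Counting shells and grid points; inverting exponential bounds. -/

theorem maxNorm_le_of_mem_indexShell {r n m : ℕ} {k : Fin r → ℕ+} (hk : k ∈ indexShell r n m) :
    maxNorm k ≤ m := (mem_indexShell.1 hk).2

theorem card_indexShell_le {r n m : ℕ} (hm : 1 ≤ m) : (indexShell r n m).card ≤ m ^ r := by
  refine (Finset.card_filter_le _ _).trans ?_
  rw [Pi.card_Icc]
  simp only [Pi.one_apply, PNat.card_Icc, Nat.toPNat'_coe, Finset.prod_const, Finset.card_univ,
    Fintype.card_fin]
  rw [if_pos (by omega)]
  simp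

theorem nonempty_indexShell {r n m : ℕ} (hr : 1 ≤ r) (hnm : n < m) :
    (indexShell r n m).Nonempty := by
  have : Nonempty (Fin r) := ⟨⟨0, hr⟩⟩
  refine ⟨fun _ => ⟨m, by omega⟩, mem_indexShell.2 ?_⟩
  have : maxNorm (fun _ : Fin r => (⟨m, by omega⟩ : ℕ+)) = m := by
    simp [maxNorm, Finset.sup_const Finset.univ_nonempty]
  rw [this]
  exact ⟨hnm, le_rfl⟩

/-- The real functionals `± re` and `± im` on `ℂ`. -/
noncomputable def signedCoordinate (σ : Bool × Bool) : ℂ →L[ℝ] ℝ :=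
  (bif σ.1 then (1 : ℝ) else -1) • (bif σ.2 then Complex.reCLM else Complex.imCLM)

theorem abs_signedCoordinate_le (σ : Bool × Bool) (z : ℂ) : |signedCoordinate σ z| ≤ ‖z‖ := by
  rcases σ with ⟨σ₁, σ₂⟩
  cases σ₁ <;> cases σ₂ <;>
    simp [signedCoordinate, Complex.abs_re_le_norm, Complex.abs_im_le_norm]

theorem norm_le_two_mul_of_signedCoordinate_le {z : ℂ} {M : ℝ}
    (h : ∀ σ, signedCoordinate σ z ≤ M) : ‖z‖ ≤ 2 * M := by
  have h1 := h (true, true)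
  have h2 := h (false, true)
  have h3 := h (true, false)
  have h4 := h (false, false)
  simp [signedCoordinate] at h1 h2 h3 h4
  have h5 : |z.re| ≤ M := abs_le.2 ⟨by linarith, h1⟩
  have h6 : |z.im| ≤ M := abs_le.2 ⟨by linarith, h3⟩
  linarith [Complex.norm_le_abs_re_add_abs_im z]

/-- The point `z / p ^ (r + 1)` of a grid in `ℝ^d`. -/
noncomputable def gridPoint {d : ℕ} (r p : ℕ) (z : Fin d → ℤ) : Fin d → ℝ :=
  fun i => z i / (p : ℝ) ^ (r + 1)

/-- Round `t i * p ^ (r + 1)` down. In the mesh, one power of `p` offsets the radius of the balls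
and the other `r` offset the number of indices in a shell. -/
theorem exists_gridPoint {d r p : ℕ} (hp : 1 ≤ p) {t : Fin d → ℝ} (ht : ∀ i, |t i| ≤ p) :
    ∃ z ∈ Fintype.piFinset fun _ : Fin d => Finset.Icc (-((p : ℤ) ^ (r + 2))) ((p : ℤ) ^ (r + 2)),
      ∀ i, |t i - gridPoint r p z i| ≤ ((p : ℝ) ^ (r + 1))⁻¹ := by
  have hp0 : (0 : ℝ) < p := by exact_mod_cast hp
  have hq : (0 : ℝ) < (p : ℝ) ^ (r + 1) := by positivity
  have hb : ∀ i, |t i * (p : ℝ) ^ (r + 1)| ≤ (p : ℝ) ^ (r + 2) := fun i => by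
    rw [abs_mul, abs_of_pos hq, pow_succ' (p : ℝ) (r + 1)]
    exact mul_le_mul_of_nonneg_right (ht i) hq.le
  refine ⟨fun i => ⌊t i * (p : ℝ) ^ (r + 1)⌋, Fintype.mem_piFinset.2 fun i => ?_, fun i => ?_⟩
  · rw [Finset.mem_Icc]
    constructor
    · rw [Int.le_floor]; push_cast; exact (abs_le.1 (hb i)).1
    · have : (⌊t i * (p : ℝ) ^ (r + 1)⌋ : ℝ) ≤ (p : ℝ) ^ (r + 2) :=
        (Int.floor_le _).trans (abs_le.1 (hb i)).2
      exact_mod_cast this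
  · have h1 := Int.floor_le (t i * (p : ℝ) ^ (r + 1))
    have h2 := Int.lt_floor_add_one (t i * (p : ℝ) ^ (r + 1))
    have h3 : t i - gridPoint r p (fun i => ⌊t i * (p : ℝ) ^ (r + 1)⌋) i =
        (t i * (p : ℝ) ^ (r + 1) - ⌊t i * (p : ℝ) ^ (r + 1)⌋) * ((p : ℝ) ^ (r + 1))⁻¹ := by
      rw [gridPoint]; field_simp
    rw [h3, abs_mul, abs_of_nonneg (by linarith), abs_of_pos (inv_pos.2 hq)]
    exact mul_le_of_le_one_left (inv_pos.2 hq).le (by linarith)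

theorem card_grid_le {d r p : ℕ} (hp : 1 ≤ p) :
    (Fintype.piFinset fun _ : Fin d =>
      Finset.Icc (-((p : ℤ) ^ (r + 2))) ((p : ℤ) ^ (r + 2))).card ≤ 3 ^ d * p ^ ((r + 2) * d) := by
  rw [Fintype.card_piFinset]
  simp only [Int.card_Icc, Finset.prod_const, Finset.card_univ, Fintype.card_fin]
  rw [pow_mul, ← mul_pow]
  refine Nat.pow_le_pow_left ?_ d
  have h1 : 1 ≤ p ^ (r + 2) := Nat.one_le_pow _ _ hp
  have h2 : ((p : ℤ) ^ (r + 2)) = ((p ^ (r + 2) : ℕ) : ℤ) := by push_cast; rfl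
  rw [h2]
  omega

/-- Bounding `W` by `exp W` and taking logarithms gives `√(l / D) * x ≤ q * l + W ≤ (q + W) * l`;
then use `√(D * l) * √(l / D) = l`. -/
theorem le_sqrt_mul_of_exp_le {x l D q W : ℝ} (hl : 1 ≤ l) (hD : 0 < D) (hW : 0 ≤ W)
    (h : Real.exp (√(l / D) * x) ≤ Real.exp (q * l) * W) : x ≤ (q + W) * √(D * l) := by
  have hl0 : 0 < l := by linarith
  have hWpos : 0 < W := by
    rcases hW.eq_or_lt with h0 | h0
    · rw [← h0, mul_zero] at h
      exact absurd h (not_le.2 (Real.exp_pos _))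
    · exact h0
  have h1 : √(l / D) * x ≤ q * l + W := by
    rw [← Real.exp_le_exp, Real.exp_add]
    refine h.trans (mul_le_mul_of_nonneg_left ?_ (Real.exp_pos _).le)
    linarith [Real.add_one_le_exp W]
  have h2 : √(l / D) * x ≤ (q + W) * l := by nlinarith
  have h3 : √(D * l) * √(l / D) = l := by
    rw [← Real.sqrt_mul (by positivity), show D * l * (l / D) = l * l by field_simp,
      Real.sqrt_mul_self hl0.le]
  have hs : 0 < √(D * l) := Real.sqrt_pos.2 (by positivity)
  have h4 := mul_le_mul_of_nonneg_left h2 hs.le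
  rw [← mul_assoc, h3] at h4
  have h5 : l * x ≤ l * ((q + W) * √(D * l)) := by linarith
  exact le_of_mul_le_mul_left h5 hl0

/-! ### Bounds for the truncated part, uniform in shells and frequencies. -/

section UniformBound

variable {d r : ℕ} {Ω : Type*} [MeasurableSpace Ω] {P : Measure Ω} [IsProbabilityMeasure P]

/-- The integrals of simple functions approximating the truncated characters at grid points satisfy
an almost sure bound that is uniform over the grids and over the shells. -/
theorem exists_ae_grid_bound {ν : (Fin r → ℕ+) → TransitionMeasure P (Fin d → ℝ)}
    (hν : TransitionMeasure.Independent ν) {a b : (Fin r → ℕ+) → ℝ} (ha : ∀ k, 0 ≤ a k)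
    (hb : ∀ k, 0 ≤ b k) {G : Set (ℕ × ℕ)}
    (hG : ∀ n m, (n, m) ∈ G → ∀ k ∈ indexShell r n m,
      ∀ᵐ ω ∂P, ((ν k).toFun ω).variation univ ≤ ENNReal.ofReal (b k))
    {D : ℕ → ℕ → ℕ → ℝ} (hD0 : ∀ n m p, (n, m) ∈ G → 3 ≤ p → 0 < D n m p)
    (hD : ∀ n m p, 3 ≤ p → ∑ k ∈ indexShell r n m, (a k * b k) ^ 2 ≤ D n m p) (k₀ : ℕ)
    {g : Bool → ℕ → (Fin d → ℤ) → (Fin r → ℕ+) → SimpleFunc (Fin d → ℝ) ℝ}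
    (hg : ∀ β p z k u, |g β p z k u| ≤ 1) :
    ∃ W : Ω → ℝ, Measurable W ∧ (∀ ω, 0 ≤ W ω) ∧ ∀ᵐ ω ∂P, ∀ n m p, (n, m) ∈ G → 3 ≤ p →
      n ≤ k₀ * p → m ≤ k₀ * p →
      ∀ z ∈ Fintype.piFinset fun _ : Fin d => Finset.Icc (-((p : ℤ) ^ (r + 2))) ((p : ℤ) ^ (r + 2)),
      ∀ β, ‖∑ k ∈ indexShell r n m, (a k : ℂ) *
        (((ν k).toFun ω).integral (g β p z k) (ContinuousLinearMap.lsmul ℝ ℝ) -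
          (ν k).expectation.integral (g β p z k) (ContinuousLinearMap.lsmul ℝ ℝ))‖ ≤
        W ω * √(D n m p * Real.log p) := by
  classical
  -- The index records the shell, the grid point, cosine or sine, and the signed coordinate. With
  -- this exponent the Hoeffding bound is `exp (log p / 2) ≤ p`.
  set V : ℕ → (ℕ × ℕ) × (Fin d → ℤ) × Bool × Bool × Bool → Ω → ℝ≥0∞ := fun p j ω =>
    ENNReal.ofReal (Real.exp (√(Real.log p / D j.1.1 j.1.2 p) *
      ∑ k ∈ indexShell r j.1.1 j.1.2, a k * signedCoordinate j.2.2.2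
        (((ν k).toFun ω).integral (g j.2.2.1 p j.2.1 k) (ContinuousLinearMap.lsmul ℝ ℝ) -
          (ν k).expectation.integral (g j.2.2.1 p j.2.1 k) (ContinuousLinearMap.lsmul ℝ ℝ))))
    with hV
  set S : ℕ → Finset ((ℕ × ℕ) × (Fin d → ℤ) × Bool × Bool × Bool) := fun p =>
    ((Finset.range (k₀ * p + 1) ×ˢ Finset.range (k₀ * p + 1)).filter fun nm => nm ∈ G ∧ 3 ≤ p) ×ˢ
      (Fintype.piFinset fun _ : Fin d => Finset.Icc (-((p : ℤ) ^ (r + 2))) ((p : ℤ) ^ (r + 2))) ×ˢ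
      Finset.univ with hSdef
  have hlog : ∀ p : ℕ, 3 ≤ p → 1 ≤ Real.log p := fun p hp => by
    rw [Real.le_log_iff_exp_le (by positivity)]
    have : (3 : ℝ) ≤ p := by exact_mod_cast hp
    linarith [Real.exp_one_lt_d9]
  have hS : ∀ p, 1 ≤ p → (S p).card ≤ ((k₀ + 1) ^ 2 * 3 ^ d * 8) * p ^ (2 + (r + 2) * d) := by
    intro p hp
    rw [hSdef]
    simp only [Finset.card_product]
    have h1 : ((Finset.range (k₀ * p + 1) ×ˢ Finset.range (k₀ * p + 1)).filter
        fun nm => nm ∈ G ∧ 3 ≤ p).card ≤ ((k₀ + 1) * p) ^ 2 := by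
      refine (Finset.card_filter_le _ _).trans ?_
      rw [Finset.card_product, Finset.card_range, ← pow_two]
      exact Nat.pow_le_pow_left (by nlinarith) 2
    refine (Nat.mul_le_mul h1 (Nat.mul_le_mul (card_grid_le hp) le_rfl)).trans (le_of_eq ?_)
    have h2 : (Finset.univ : Finset (Bool × Bool × Bool)).card = 8 := rfl
    rw [h2]
    ring
  have hE : ∀ p, 1 ≤ p → ∀ j ∈ S p, ∫⁻ ω, V p j ω ∂P ≤ (p : ℝ≥0∞) ^ 1 := by
    intro p hp j hj
    rw [hSdef] at hj
    simp only [Finset.mem_product, Finset.mem_filter] at hj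
    obtain ⟨⟨-, hjG, hp3⟩, -⟩ := hj
    refine (TransitionMeasure.lintegral_exp_sum_le hν _ ha hb (hG _ _ hjG)
      (fun k u => hg _ _ _ k u) (abs_signedCoordinate_le _) (hD _ _ p hp3) _).trans ?_
    have hl := hlog p hp3
    have hDp := hD0 j.1.1 j.1.2 p hjG hp3
    rw [Real.sq_sqrt (by positivity), pow_one, ← ENNReal.ofReal_natCast]
    refine ENNReal.ofReal_le_ofReal ?_
    rw [← Real.le_log_iff_exp_le (by positivity), mul_div_cancel₀ _ hDp.ne']
    linarith
  have hVm : ∀ p j, Measurable (V p j) := fun p j => by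
    refine (Real.measurable_exp.comp (Measurable.const_mul (Finset.measurable_fun_sum _ fun k _ =>
      Measurable.const_mul ((signedCoordinate _).measurable.comp ?_) _) _)).ennreal_ofReal
    exact ((ν k).measurable_integral_simpleFunc _).sub_const _
  obtain ⟨W, hWm, hW0, hW⟩ := exists_ae_forall_le_pow_mul hVm hS hE
  -- This is `e + c + 2`, where `e = 2 + (r + 2) * d` counts pairs `(n, m)` and grid points, and `c
  -- = 1` bounds the means.
  set q : ℕ := 2 + (r + 2) * d + 1 + 2 with hq
  refine ⟨fun ω => 2 * (q + W ω), (hWm.const_add _).const_mul _,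
    fun ω => mul_nonneg zero_le_two (add_nonneg q.cast_nonneg (hW0 ω)), ?_⟩
  filter_upwards [hW] with ω hω n m p hnm hp hn hm z hz β
  have hp0 : (0 : ℝ) < p := by positivity
  rw [mul_assoc]
  refine norm_le_two_mul_of_signedCoordinate_le fun σ => ?_
  refine le_sqrt_mul_of_exp_le (hlog p hp) (hD0 n m p hnm hp) (hW0 ω) ?_
  have h1 := hω p (by omega) ((n, m), z, β, σ) (by
    rw [hSdef]
    simp only [Finset.mem_product, Finset.mem_filter, Finset.mem_univ, and_true, Finset.mem_range]
    exact ⟨⟨⟨by omega, by omega⟩, hnm, hp⟩, hz⟩)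
  rw [hV] at h1
  simp only at h1
  rw [ENNReal.ofReal_le_ofReal_iff (mul_nonneg (by positivity) (hW0 ω))] at h1
  rw [Real.exp_nat_mul, Real.exp_log hp0]
  refine le_trans (le_of_eq ?_) h1
  congr 2
  rw [map_sum]
  refine Finset.sum_congr rfl fun k _ => ?_
  rw [← Complex.real_smul, map_smul, smul_eq_mul]

/-- Passage from the grid to all `t` in the cube of half-side `p`. The set `G` holds the shells on
which the variation bounds `b` are valid and `D` is positive. -/
theorem exists_ae_truncatedTransform_bound
    {ν : (Fin r → ℕ+) → TransitionMeasure P (Fin d → ℝ)}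
    (hν : TransitionMeasure.Independent ν) {φ : ℝ → ℝ} (hφ0 : ∀ x, 0 ≤ φ x)
    (hφm : MonotoneOn φ (Set.Ici 0)) {c₀ : ℝ} (hc₀ : 0 < c₀) (hφ : ∀ x, c₀ * |x| ≤ φ x)
    {a b : (Fin r → ℕ+) → ℝ} (ha : ∀ k, 0 ≤ a k) (hb : ∀ k, 0 ≤ b k) {G : Set (ℕ × ℕ)}
    (hG : ∀ n m, (n, m) ∈ G → ∀ k ∈ indexShell r n m,
      ∀ᵐ ω ∂P, ((ν k).toFun ω).variation univ ≤ ENNReal.ofReal (b k))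
    {D : ℕ → ℕ → ℕ → ℝ} (hD0 : ∀ n m p, (n, m) ∈ G → 3 ≤ p → 0 < D n m p)
    (hD : ∀ n m p, 3 ≤ p → ∑ k ∈ indexShell r n m, (a k * b k) ^ 2 ≤ D n m p) :
    ∃ W : Ω → ℝ, Measurable W ∧ (∀ ω, 0 ≤ W ω) ∧ ∀ᵐ ω ∂P, ∀ n m p : ℕ, n < m → (n, m) ∈ G →
      3 ≤ p → φ m ≤ p → ∀ t : Fin d → ℝ, (∀ i, |t i| ≤ p) →
      ‖∑ k ∈ indexShell r n m, (a k : ℂ) *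
        (truncatedTransform {u | ‖u‖ ≤ φ (maxNorm k)} ((ν k).toFun ω) t -
          truncatedTransform {u | ‖u‖ ≤ φ (maxNorm k)} (ν k).expectation t)‖ ≤
        W ω * √(D n m p * Real.log p) := by
  have hcs : ∀ (β : Bool) (p : ℕ) (z : Fin d → ℤ) (k : Fin r → ℕ+),
      ∃ g : SimpleFunc (Fin d → ℝ) ℝ, (∀ u, |g u| ≤ 1) ∧
        ∀ u, |{u : Fin d → ℝ | ‖u‖ ≤ φ (maxNorm k)}.indicator
          (fun u => (bif β then Real.cos (gridPoint r p z ⬝ᵥ u)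
            else Real.sin (gridPoint r p z ⬝ᵥ u))) u - g u| ≤ ((p ^ r + 1 : ℕ) : ℝ)⁻¹ := by
    intro β p z k
    have hB : MeasurableSet {u : Fin d → ℝ | ‖u‖ ≤ φ (maxNorm k)} :=
      measurableSet_le measurable_norm measurable_const
    have hdot : Measurable fun u : Fin d → ℝ => gridPoint r p z ⬝ᵥ u := by
      unfold dotProduct; fun_prop
    refine exists_simpleFunc_abs_sub_le ?_ (fun u => ?_) (Nat.succ_pos _)
    · cases β
      · exact (Real.measurable_sin.comp hdot).indicator hB
      · exact (Real.measurable_cos.comp hdot).indicator hB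
    · rw [← Real.norm_eq_abs]
      refine (norm_indicator_le_norm_self _ u).trans ?_
      cases β
      · exact Real.abs_sin_le_one _
      · exact Real.abs_cos_le_one _
  choose g hg1 hg2 using hcs
  -- From `c₀ * m ≤ φ m ≤ p` it follows that `m ≤ k₀ * p`, so each `p` sees finitely many shells.
  obtain ⟨k₀, hk₀⟩ := exists_nat_ge c₀⁻¹
  obtain ⟨W, hWm, hW0, hW⟩ := exists_ae_grid_bound hν ha hb hG hD0 hD k₀ hg1
  -- The two copies of `W` bound the cosine and sine sums; the constant is the discretisation error.
  refine ⟨fun ω => 2 * W ω + 2 * (d + 2) * k₀ ^ r, (hWm.const_mul _).add_const _,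
    fun ω => add_nonneg (mul_nonneg zero_le_two (hW0 ω)) (by positivity), ?_⟩
  have hall : ∀ᵐ ω ∂P, ∀ n m, (n, m) ∈ G → ∀ k ∈ indexShell r n m,
      ((ν k).toFun ω).variation univ ≤ ENNReal.ofReal (b k) := by
    simp only [ae_all_iff]
    intro n m h k hk
    exact hG n m h k hk
  filter_upwards [hW, hall] with ω hω hvar n m p hnm hnmG hp hφp t ht
  have hp0 : (0 : ℝ) < p := by positivity
  have hp1 : 1 ≤ p := by omega
  obtain ⟨z, hz, htz⟩ := exists_gridPoint (r := r) hp1 ht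
  have hl : 1 ≤ Real.log p := by
    rw [Real.le_log_iff_exp_le hp0]
    have : (3 : ℝ) ≤ p := by exact_mod_cast hp
    linarith [Real.exp_one_lt_d9]
  have hDp := hD0 n m p hnmG hp
  have hm : m ≤ k₀ * p := by
    have h1 := (hφ m).trans hφp
    rw [Nat.abs_cast] at h1
    have h2 : (m : ℝ) ≤ c₀⁻¹ * p := by
      rw [inv_mul_eq_div, le_div_iff₀ hc₀]; linarith
    have h3 : (m : ℝ) ≤ k₀ * p := h2.trans (mul_le_mul_of_nonneg_right hk₀ hp0.le)
    exact_mod_cast h3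
  -- Relative error per index: `d` from the mesh, `2` from the simple functions.
  set η : ℝ := (d + 2) * ((p : ℝ) ^ r)⁻¹ with hη
  have hη0 : 0 ≤ η := by positivity
  have happrox : ∀ k ∈ indexShell r n m, ∀ μ : ComplexMeasure (Fin d → ℝ),
      μ.variation univ ≤ ENNReal.ofReal (b k) →
      ‖truncatedTransform {u | ‖u‖ ≤ φ (maxNorm k)} μ t -
        (μ.integral (g true p z k) (ContinuousLinearMap.lsmul ℝ ℝ) +
          Complex.I * μ.integral (g false p z k) (ContinuousLinearMap.lsmul ℝ ℝ))‖ ≤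
        η * b k := by
    intro k hk μ hμ
    have hρ : φ (maxNorm k) ≤ p := by
      refine le_trans (hφm (by simp) (by simp) ?_) hφp
      exact_mod_cast maxNorm_le_of_mem_indexShell hk
    refine (norm_truncatedTransform_sub_le μ (by positivity) (hφ0 _) htz
      (hg2 true p z k) (hg2 false p z k)).trans ?_
    refine mul_le_mul ?_ (TransitionMeasure.variation_real_le (hb k) hμ) measureReal_nonneg hη0
    have h1 : ((p : ℝ) ^ (r + 1))⁻¹ * φ (maxNorm k) ≤ ((p : ℝ) ^ r)⁻¹ := by
      refine (mul_le_mul_of_nonneg_left hρ (by positivity)).trans (le_of_eq ?_)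
      field_simp
      ring
    have h2 : ((p ^ r + 1 : ℕ) : ℝ)⁻¹ ≤ ((p : ℝ) ^ r)⁻¹ := by
      refine inv_anti₀ (by positivity) ?_
      push_cast
      linarith
    rw [hη, add_mul]
    exact add_le_add (mul_le_mul_of_nonneg_left h1 d.cast_nonneg) (by linarith)
  set X : Bool → (Fin r → ℕ+) → ℂ := fun β k =>
    ((ν k).toFun ω).integral (g β p z k) (ContinuousLinearMap.lsmul ℝ ℝ) -
      (ν k).expectation.integral (g β p z k) (ContinuousLinearMap.lsmul ℝ ℝ) with hX
  set Q : (Fin r → ℕ+) → ℂ := fun k =>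
    truncatedTransform {u | ‖u‖ ≤ φ (maxNorm k)} ((ν k).toFun ω) t -
      truncatedTransform {u | ‖u‖ ≤ φ (maxNorm k)} (ν k).expectation t with hQ
  have hdiff : ∀ k ∈ indexShell r n m,
      ‖(a k : ℂ) * (Q k - (X true k + Complex.I * X false k))‖ ≤ 2 * η * √(D n m p) := by
    intro k hk
    have h1 := happrox k hk _ (hvar n m hnmG k hk)
    have h2 := happrox k hk _ ((ν k).variation_expectation_univ_le (hG n m hnmG k hk))
    have h3 : ‖Q k - (X true k + Complex.I * X false k)‖ ≤ η * b k + η * b k := by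
      refine le_trans (le_of_eq ?_) ((norm_sub_le _ _).trans (add_le_add h1 h2))
      congr 1
      rw [hQ, hX]
      ring
    have h4 : a k * b k ≤ √(D n m p) := by
      refine Real.le_sqrt_of_sq_le (le_trans ?_ (hD n m p hp))
      exact Finset.single_le_sum (f := fun k => (a k * b k) ^ 2) (fun _ _ => sq_nonneg _) hk
    rw [norm_mul, Complex.norm_real, Real.norm_of_nonneg (ha k)]
    calc a k * ‖Q k - (X true k + Complex.I * X false k)‖
        ≤ a k * (η * b k + η * b k) := mul_le_mul_of_nonneg_left h3 (ha k)
      _ = 2 * η * (a k * b k) := by ring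
      _ ≤ 2 * η * √(D n m p) := mul_le_mul_of_nonneg_left h4 (by positivity)
  have hsplit : ∑ k ∈ indexShell r n m, (a k : ℂ) * Q k =
      ∑ k ∈ indexShell r n m, (a k : ℂ) * (Q k - (X true k + Complex.I * X false k)) +
        (∑ k ∈ indexShell r n m, (a k : ℂ) * X true k +
          Complex.I * ∑ k ∈ indexShell r n m, (a k : ℂ) * X false k) := by
    rw [Finset.mul_sum, ← Finset.sum_add_distrib, ← Finset.sum_add_distrib]
    exact Finset.sum_congr rfl fun k _ => by ring
  have hcard : ((indexShell r n m).card : ℝ) * (2 * η) ≤ 2 * (d + 2) * k₀ ^ r := by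
    have h1 : (indexShell r n m).card ≤ (k₀ * p) ^ r :=
      (card_indexShell_le (by omega)).trans (Nat.pow_le_pow_left hm r)
    have h2 : ((indexShell r n m).card : ℝ) ≤ (k₀ : ℝ) ^ r * (p : ℝ) ^ r := by
      rw [← mul_pow]; exact_mod_cast h1
    refine (mul_le_mul_of_nonneg_right h2 (by positivity)).trans (le_of_eq ?_)
    rw [hη]
    field_simp
  have hsqrt : √(D n m p) ≤ √(D n m p * Real.log p) :=
    Real.sqrt_le_sqrt (le_mul_of_one_le_right hDp.le hl)
  have e1 : ‖∑ k ∈ indexShell r n m, (a k : ℂ) * (Q k - (X true k + Complex.I * X false k))‖ ≤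
      2 * (d + 2) * k₀ ^ r * √(D n m p * Real.log p) := by
    refine (norm_sum_le_of_le _ hdiff).trans ?_
    rw [Finset.sum_const, nsmul_eq_mul, ← mul_assoc]
    exact mul_le_mul hcard hsqrt (Real.sqrt_nonneg _) (by positivity)
  have e2 := hω n m p hnmG hp (by omega) hm z hz true
  have e3 := hω n m p hnmG hp (by omega) hm z hz false
  rw [hsplit]
  refine (norm_add_le _ _).trans ?_
  refine (add_le_add e1 (norm_add_le _ _)).trans ?_
  rw [norm_mul, Complex.norm_I, one_mul]
  linarith

end UniformBound

/-- Used with `M = max (φ m) T` to choose the integer level `p`; the factor 2 comes from `M + 1 ≤ M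
^ 2`. -/
theorem natCeil_bounds {M : ℝ} (hM : 2 < M) :
    3 ≤ ⌈M⌉₊ ∧ M ≤ ⌈M⌉₊ ∧ Real.log ⌈M⌉₊ ≤ 2 * Real.log M := by
  have h1 : 2 < ⌈M⌉₊ := Nat.lt_ceil.2 (by exact_mod_cast hM)
  refine ⟨h1, Nat.le_ceil M, ?_⟩
  have h2 : (⌈M⌉₊ : ℝ) ≤ M ^ 2 := (Nat.ceil_lt_add_one (by linarith)).le.trans (by nlinarith)
  calc Real.log ⌈M⌉₊ ≤ Real.log (M ^ 2) := Real.log_le_log (by positivity) h2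
    _ = 2 * Real.log M := by rw [Real.log_pow]; norm_num

/-! ### The tails outside the balls. -/

section Remainder

variable {d : ℕ} {ι : Type*} [Countable ι] {Ω : Type*} [MeasurableSpace Ω] {P : Measure Ω}

/-- Weighted sums of the transforms truncated to sets of summable expected variation are almost
surely bounded, uniformly in `t`. -/
theorem exists_ae_sum_truncatedTransform_le {ν : ι → TransitionMeasure P (Fin d → ℝ)}
    {B : ι → Set (Fin d → ℝ)} (hB : ∀ k, MeasurableSet (B k)) {w : ι → ℝ} (hw : ∀ k, 0 ≤ w k)
    (h : ∑' k, ENNReal.ofReal (w k) * (ν k).expVariation (B k) < ⊤) :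
    ∃ R : Ω → ℝ, Measurable R ∧ (∀ ω, 0 ≤ R ω) ∧ ∀ᵐ ω ∂P, ∀ (F : Finset ι) (t : Fin d → ℝ),
      ∑ k ∈ F, w k * ‖truncatedTransform (B k) ((ν k).toFun ω) t -
        truncatedTransform (B k) (ν k).expectation t‖ ≤ R ω := by
  choose f hfm hf hfint using fun k => (ν k).exists_measurable_bound (hB k)
  set U : Ω → ℝ≥0∞ := fun ω => ∑' k, ENNReal.ofReal (w k) * f k ω with hU
  have hUm : Measurable U := Measurable.tsum fun k => (hfm k).const_mul _
  have hUint : ∫⁻ ω, U ω ∂P ≠ ⊤ := by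
    refine ne_top_of_le_ne_top h.ne ?_
    rw [lintegral_tsum fun k => ((hfm k).const_mul _).aemeasurable]
    refine ENNReal.tsum_le_tsum fun k => ?_
    rw [lintegral_const_mul _ (hfm k)]
    exact mul_le_mul_right (hfint k) _
  refine ⟨fun ω => (U ω).toReal + (∑' k, ENNReal.ofReal (w k) * (ν k).expVariation (B k)).toReal,
    hUm.ennreal_toReal.add_const _, fun ω => by positivity, ?_⟩
  filter_upwards [ae_lt_top hUm hUint] with ω hω F t
  rw [← ENNReal.toReal_add hω.ne h.ne]
  refine (ENNReal.ofReal_le_iff_le_toReal (ENNReal.add_ne_top.2 ⟨hω.ne, h.ne⟩)).1 ?_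
  rw [ENNReal.ofReal_sum_of_nonneg fun k _ => mul_nonneg (hw k) (norm_nonneg _),
    ← ENNReal.tsum_add]
  refine (Finset.sum_le_sum fun k _ => ?_).trans (ENNReal.sum_le_tsum F)
  rw [ENNReal.ofReal_mul (hw k), ofReal_norm, ← mul_add]
  refine mul_le_mul_right ((enorm_sub_le).trans (add_le_add (hf k ω t) ?_)) _
  exact (enorm_truncatedTransform_le (hB k) _ t).trans ((ν k).variation_expectation_le (hB k))

end Remainder

theorem norm_sum_fourierStieltjes_sub_le {d : ℕ} {ι : Type*} (F : Finset ι) {a : ι → ℝ}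
    (ha : ∀ k, 0 ≤ a k) {B : ι → Set (Fin d → ℝ)} (hB : ∀ k, MeasurableSet (B k))
    (μ η : ι → ComplexMeasure (Fin d → ℝ)) (t : Fin d → ℝ) :
    ‖∑ k ∈ F, (a k : ℂ) * (fourierStieltjes (μ k) t - fourierStieltjes (η k) t)‖ ≤
      ‖∑ k ∈ F, (a k : ℂ) * (truncatedTransform (B k) (μ k) t -
        truncatedTransform (B k) (η k) t)‖ +
      ∑ k ∈ F, a k * ‖truncatedTransform (B k)ᶜ (μ k) t - truncatedTransform (B k)ᶜ (η k) t‖ := by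
  have h : ∑ k ∈ F, (a k : ℂ) * (fourierStieltjes (μ k) t - fourierStieltjes (η k) t) =
      ∑ k ∈ F, (a k : ℂ) * (truncatedTransform (B k) (μ k) t -
        truncatedTransform (B k) (η k) t) +
      ∑ k ∈ F, (a k : ℂ) * (truncatedTransform (B k)ᶜ (μ k) t -
        truncatedTransform (B k)ᶜ (η k) t) := by
    rw [← Finset.sum_add_distrib]
    refine Finset.sum_congr rfl fun k _ => ?_
    rw [fourierStieltjes_eq_add (hB k), fourierStieltjes_eq_add (hB k)]
    ring
  rw [h]
  refine (norm_add_le _ _).trans (add_le_add le_rfl (norm_sum_le_of_le _ fun k _ => ?_))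
  rw [norm_mul, Complex.norm_real, Real.norm_of_nonneg (ha k)]

/-- Each `a k` is at most the `ℓ²` norm. In the probability case this makes the tail scale like the
main term. -/
theorem sum_mul_le_sqrt_mul_sum {ι : Type*} (F : Finset ι) {a x : ι → ℝ}
    (hx : ∀ k, 0 ≤ x k) : ∑ k ∈ F, a k * x k ≤ √(∑ k ∈ F, a k ^ 2) * ∑ k ∈ F, x k := by
  rw [Finset.mul_sum]
  refine Finset.sum_le_sum fun k hk => mul_le_mul_of_nonneg_right ?_ (hx k)
  exact Real.le_sqrt_of_sq_le (Finset.single_le_sum (f := fun k => a k ^ 2)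
    (fun _ _ => sq_nonneg _) hk)

/-! ### Assembling the two bounds. -/

section Main

variable {d r : ℕ} {Ω : Type*} [MeasurableSpace Ω] {P : Measure Ω} [IsProbabilityMeasure P]

theorem exists_ae_bound_complex {φ : ℝ → ℝ} (hφ0 : ∀ x, 0 ≤ φ x) (hφm : MonotoneOn φ (Set.Ici 0))
    {c₀ : ℝ} (hc₀ : 0 < c₀) (hφ : ∀ x, c₀ * |x| ≤ φ x)
    {ν : (Fin r → ℕ+) → TransitionMeasure P (Fin d → ℝ)}
    (hν : TransitionMeasure.Independent ν) {a : (Fin r → ℕ+) → ℝ} (ha : ∀ k, 0 < a k)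
    (hsum : ∑' k, ENNReal.ofReal (a k) * (ν k).expVariation {u | φ (maxNorm k) < ‖u‖} < ⊤) :
    ∃ C : Ω → ℝ, Measurable C ∧ (∀ ω, 0 < C ω) ∧
      ∀ᵐ ω ∂P, ∀ n m : ℕ, n < m → ∀ T : ℝ, 2 < T →
        ∀ t : Fin d → ℝ, (∀ i, t i ∈ Set.Icc (-T) T) →
          ‖∑ k ∈ indexShell r n m, (a k : ℂ) *
              (fourierStieltjes ((ν k).toFun ω) t
                - fourierStieltjes (ν k).expectation t)‖ₑ ^ 2
            ≤ ENNReal.ofReal (C ω) *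
              (1 + (∑ k ∈ indexShell r n m,
                  ENNReal.ofReal (a k ^ 2) * (ν k).supVariation ^ 2) *
                ENNReal.ofReal (Real.log (max (φ m) T))) := by
  have hB : ∀ k : Fin r → ℕ+, MeasurableSet {u : Fin d → ℝ | ‖u‖ ≤ φ (maxNorm k)} :=
    fun k => measurableSet_le measurable_norm measurable_const
  have hcompl : ∀ k : Fin r → ℕ+, {u : Fin d → ℝ | ‖u‖ ≤ φ (maxNorm k)}ᶜ =
      {u | φ (maxNorm k) < ‖u‖} := fun k => by ext u; simp
  simp_rw [← hcompl] at hsum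
  obtain ⟨R, hRm, hR0, hR⟩ := exists_ae_sum_truncatedTransform_le (fun k => (hB k).compl)
    (fun k => (ha k).le) hsum
  have hlog : ∀ p : ℕ, 3 ≤ p → 0 < Real.log p := fun p hp =>
    Real.log_pos (by exact_mod_cast (by omega : 1 < p))
  obtain ⟨W, hWm, hW0, hW⟩ := exists_ae_truncatedTransform_bound hν hφ0 hφm hc₀ hφ
    (a := a) (b := fun k => (ν k).supVariation.toReal) (fun k => (ha k).le)
    (fun k => ENNReal.toReal_nonneg)
    (G := {nm | ∀ k ∈ indexShell r nm.1 nm.2, (ν k).supVariation ≠ ⊤})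
    (fun n m hnm k hk => by
      rw [ENNReal.ofReal_toReal (hnm k hk)]
      exact ae_le_essSup)
    -- The extra `1 / log p` keeps `D` positive when the sum vanishes; multiplied by `log p` it
    -- becomes the summand 1 of the bound.
    (D := fun n m p => ∑ k ∈ indexShell r n m, (a k * (ν k).supVariation.toReal) ^ 2 +
      1 / Real.log p)
    (fun n m p _ hp => by have := hlog p hp; positivity)
    (fun n m p hp => by have := hlog p hp; simp only [le_add_iff_nonneg_right]; positivity)
  refine ⟨fun ω => 4 * W ω ^ 2 + 2 * R ω ^ 2 + 1,
    (((hWm.pow_const 2).const_mul 4).add ((hRm.pow_const 2).const_mul 2)).add_const 1,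
    fun ω => by positivity, ?_⟩
  filter_upwards [hR, hW] with ω hRω hWω n m hnm T hT t ht
  set M : ℝ := max (φ m) T with hM
  have hM2 : 2 < M := hT.trans_le (le_max_right _ _)
  have hlM : 0 < Real.log M := Real.log_pos (by linarith)
  by_cases hfin : ∀ k ∈ indexShell r n m, (ν k).supVariation ≠ ⊤
  · obtain ⟨hp3, hMp, hlogp⟩ := natCeil_bounds hM2
    set p := ⌈M⌉₊
    have hlp := hlog p hp3
    set A : ℝ := ∑ k ∈ indexShell r n m, (a k * (ν k).supVariation.toReal) ^ 2 with hA
    have hA0 : 0 ≤ A := Finset.sum_nonneg fun _ _ => sq_nonneg _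
    have hsumA : (∑ k ∈ indexShell r n m, ENNReal.ofReal (a k ^ 2) * (ν k).supVariation ^ 2) =
        ENNReal.ofReal A := by
      rw [hA, ENNReal.ofReal_sum_of_nonneg fun _ _ => sq_nonneg _]
      refine Finset.sum_congr rfl fun k hk => ?_
      rw [mul_pow, ENNReal.ofReal_mul (sq_nonneg _), ENNReal.ofReal_pow ENNReal.toReal_nonneg,
        ENNReal.ofReal_toReal (hfin k hk)]
    have h1 := norm_sum_fourierStieltjes_sub_le (indexShell r n m) (fun k => (ha k).le) hB
      (fun k => (ν k).toFun ω) (fun k => (ν k).expectation) t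
    have h2 := hWω n m p hnm hfin hp3 ((le_max_left _ _).trans hMp) t
      fun i => (abs_le.2 (ht i)).trans ((le_max_right _ _).trans hMp)
    have h3 := hRω (indexShell r n m) t
    have h4 : (A + 1 / Real.log p) * Real.log p = A * Real.log p + 1 := by field_simp
    rw [h4] at h2
    have h5 := h1.trans (add_le_add h2 h3)
    rw [hsumA, ← ENNReal.ofReal_mul hA0, ← ENNReal.ofReal_one,
      ← ENNReal.ofReal_add zero_le_one (by positivity), ← ENNReal.ofReal_mul (by positivity),
      ← ofReal_norm, ← ENNReal.ofReal_pow (norm_nonneg _)]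
    refine ENNReal.ofReal_le_ofReal ((pow_le_pow_left₀ (norm_nonneg _) h5 2).trans ?_)
    refine add_sq_le.trans ?_
    rw [mul_pow, Real.sq_sqrt (by positivity)]
    have h6 : A * Real.log p ≤ 2 * (A * Real.log M) := by
      nlinarith [mul_le_mul_of_nonneg_left hlogp hA0]
    have h7 : 0 ≤ A * Real.log M := by positivity
    have h8 : W ω ^ 2 * (A * Real.log p + 1) ≤ W ω ^ 2 * (2 * (1 + A * Real.log M)) :=
      mul_le_mul_of_nonneg_left (by linarith) (sq_nonneg _)
    have h9 : 0 ≤ R ω ^ 2 * (A * Real.log M) := by positivity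
    linarith
  -- An infinite essential supremum in the shell makes the right side infinite, since `a k`, `log M`
  -- and `C ω` are positive.
  · push Not at hfin
    obtain ⟨k, hk, hktop⟩ := hfin
    have h1 : (∑ k ∈ indexShell r n m, ENNReal.ofReal (a k ^ 2) * (ν k).supVariation ^ 2) = ⊤ := by
      refine ENNReal.sum_eq_top.2 ⟨k, hk, ?_⟩
      rw [hktop, ENNReal.top_pow two_ne_zero]
      exact ENNReal.mul_top (ENNReal.ofReal_pos.2 (pow_pos (ha k) 2)).ne'
    have h2 : ENNReal.ofReal (4 * W ω ^ 2 + 2 * R ω ^ 2 + 1) ≠ 0 :=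
      (ENNReal.ofReal_pos.2 (by positivity)).ne'
    rw [h1, ENNReal.top_mul (ENNReal.ofReal_pos.2 hlM).ne', add_top, ENNReal.mul_top h2]
    exact le_top

theorem exists_ae_bound_probability (hr : 1 ≤ r) {φ : ℝ → ℝ} (hφ0 : ∀ x, 0 ≤ φ x)
    (hφm : MonotoneOn φ (Set.Ici 0)) {c₀ : ℝ} (hc₀ : 0 < c₀) (hφ : ∀ x, c₀ * |x| ≤ φ x)
    {ν : (Fin r → ℕ+) → TransitionMeasure P (Fin d → ℝ)}
    (hν : TransitionMeasure.Independent ν) {a : (Fin r → ℕ+) → ℝ} (ha : ∀ k, 0 < a k)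
    (hprob : ∀ k, (ν k).IsProbability)
    (hsum : ∑' k, (ν k).expVariation {u | φ (maxNorm k) < ‖u‖} < ⊤) :
    ∃ C : Ω → ℝ, Measurable C ∧ (∀ ω, 0 < C ω) ∧
      ∀ᵐ ω ∂P, ∀ n m : ℕ, n < m → ∀ T : ℝ, 2 < T →
        ∀ t : Fin d → ℝ, (∀ i, t i ∈ Set.Icc (-T) T) →
          ‖∑ k ∈ indexShell r n m, (a k : ℂ) *
              (fourierStieltjes ((ν k).toFun ω) t
                - fourierStieltjes (ν k).expectation t)‖ ^ 2
            ≤ C ω * ((∑ k ∈ indexShell r n m, a k ^ 2) * Real.log (max (φ m) T)) := by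
  have hB : ∀ k : Fin r → ℕ+, MeasurableSet {u : Fin d → ℝ | ‖u‖ ≤ φ (maxNorm k)} :=
    fun k => measurableSet_le measurable_norm measurable_const
  have hcompl : ∀ k : Fin r → ℕ+, {u : Fin d → ℝ | ‖u‖ ≤ φ (maxNorm k)}ᶜ =
      {u | φ (maxNorm k) < ‖u‖} := fun k => by ext u; simp
  simp_rw [← hcompl] at hsum
  obtain ⟨R, hRm, hR0, hR⟩ := exists_ae_sum_truncatedTransform_le (fun k => (hB k).compl)
    (w := fun _ => 1) (fun _ => zero_le_one) (by simpa using hsum)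
  obtain ⟨W, hWm, hW0, hW⟩ := exists_ae_truncatedTransform_bound hν hφ0 hφm hc₀ hφ
    (a := a) (b := fun _ => 1) (fun k => (ha k).le) (fun _ => zero_le_one)
    (G := {nm | nm.1 < nm.2})
    (fun n m _ k _ => ae_of_all _ fun ω => by
      simpa using TransitionMeasure.variation_univ_le_one (hprob k) ω)
    -- Positive because the shell is nonempty, so no additive 1 is needed.
    (D := fun n m p => ∑ k ∈ indexShell r n m, a k ^ 2)
    (fun n m p hnm _ => Finset.sum_pos (fun k _ => pow_pos (ha k) 2)
      (nonempty_indexShell hr hnm))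
    (fun n m p hp => by simp)
  refine ⟨fun ω => 4 * W ω ^ 2 + 4 * R ω ^ 2 + 1,
    (((hWm.pow_const 2).const_mul 4).add ((hRm.pow_const 2).const_mul 4)).add_const 1,
    fun ω => by positivity, ?_⟩
  filter_upwards [hR, hW] with ω hRω hWω n m hnm T hT t ht
  set M : ℝ := max (φ m) T with hM
  have hM2 : 2 < M := hT.trans_le (le_max_right _ _)
  -- This lets the tail contribution `R ω ^ 2 * A` be absorbed into `A * log M`.
  have hlM : 1 / 2 ≤ Real.log M := by
    have := Real.log_le_log two_pos hM2.le
    linarith [Real.log_two_gt_d9]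
  obtain ⟨hp3, hMp, hlogp⟩ := natCeil_bounds hM2
  set p := ⌈M⌉₊
  have hlp : 0 < Real.log p := Real.log_pos (by exact_mod_cast (by omega : 1 < p))
  set A : ℝ := ∑ k ∈ indexShell r n m, a k ^ 2 with hA
  have hA0 : 0 ≤ A := Finset.sum_nonneg fun _ _ => sq_nonneg _
  have h1 := norm_sum_fourierStieltjes_sub_le (indexShell r n m) (fun k => (ha k).le) hB
    (fun k => (ν k).toFun ω) (fun k => (ν k).expectation) t
  have h2 := hWω n m p hnm hnm hp3 ((le_max_left _ _).trans hMp) t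
    fun i => (abs_le.2 (ht i)).trans ((le_max_right _ _).trans hMp)
  have h3 := hRω (indexShell r n m) t
  simp only [one_mul] at h3
  have h4 := (sum_mul_le_sqrt_mul_sum (indexShell r n m) (a := a) fun k => norm_nonneg
    (truncatedTransform {u | ‖u‖ ≤ φ (maxNorm k)}ᶜ ((ν k).toFun ω) t -
      truncatedTransform {u | ‖u‖ ≤ φ (maxNorm k)}ᶜ (ν k).expectation t)).trans
    (mul_le_mul_of_nonneg_left h3 (Real.sqrt_nonneg _))
  have h5 := h1.trans (add_le_add h2 h4)
  refine (pow_le_pow_left₀ (norm_nonneg _) h5 2).trans (add_sq_le.trans ?_)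
  rw [mul_pow, mul_pow, Real.sq_sqrt (by positivity), Real.sq_sqrt hA0]
  have h6 : A * Real.log p ≤ 2 * (A * Real.log M) := by
    nlinarith [mul_le_mul_of_nonneg_left hlogp hA0]
  have h7 : A ≤ 2 * (A * Real.log M) := by nlinarith
  have h8 := mul_le_mul_of_nonneg_left h6 (sq_nonneg (W ω))
  have h9 := mul_le_mul_of_nonneg_left h7 (sq_nonneg (R ω))
  have h10 : 0 ≤ A * Real.log M := mul_nonneg hA0 (by linarith)
  linarith

end Main

theorem mainTheorem6 (d : ℕ) (hd : 1 ≤ d) :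
    ∃ c : ℝ, 0 < c ∧
      ∀ (Ω : Type*) [MeasurableSpace Ω] (P : Measure Ω) [IsProbabilityMeasure P]
        (r : ℕ) (_ : 1 ≤ r)
        (φ : ℝ → ℝ) (_ : ∀ x, 0 ≤ φ x) (_ : MonotoneOn φ (Set.Ici 0))
        (_ : ∃ c₀ : ℝ, 0 < c₀ ∧ ∀ x, c₀ * |x| ≤ φ x)
        (ν : (Fin r → ℕ+) → TransitionMeasure P (Fin d → ℝ))
        (_ : TransitionMeasure.Independent ν)
        (a : (Fin r → ℕ+) → ℝ) (_ : ∀ k, 0 < a k ∧ a k ≤ 1),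
        -- complex valued transition measures
        ((∑' k, ENNReal.ofReal (a k) * (ν k).expVariation {u | φ (maxNorm k) < ‖u‖} < ⊤) →
          ∃ C : Ω → ℝ, Measurable C ∧ (∀ ω, 0 < C ω) ∧
            ∀ᵐ ω ∂P, ∀ n m : ℕ, n < m → ∀ T : ℝ, 2 < T →
              ∀ t : Fin d → ℝ, (∀ i, t i ∈ Set.Icc (-T) T) →
                ‖∑ k ∈ indexShell r n m, (a k : ℂ) *
                    (fourierStieltjes ((ν k).toFun ω) t
                      - fourierStieltjes (ν k).expectation t)‖ₑ ^ 2
                  ≤ ENNReal.ofReal (c * C ω) *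
                    (1 + (∑ k ∈ indexShell r n m,
                        ENNReal.ofReal (a k ^ 2) * (ν k).supVariation ^ 2) *
                      ENNReal.ofReal (Real.log (max (φ m) T)))) ∧
        -- probability transition measures
        ((∀ k, (ν k).IsProbability) →
          (∑' k, (ν k).expVariation {u | φ (maxNorm k) < ‖u‖} < ⊤) →
          ∃ C : Ω → ℝ, Measurable C ∧ (∀ ω, 0 < C ω) ∧
            ∀ᵐ ω ∂P, ∀ n m : ℕ, n < m → ∀ T : ℝ, 2 < T →
              ∀ t : Fin d → ℝ, (∀ i, t i ∈ Set.Icc (-T) T) →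
                ‖∑ k ∈ indexShell r n m, (a k : ℂ) *
                    (fourierStieltjes ((ν k).toFun ω) t
                      - fourierStieltjes (ν k).expectation t)‖ ^ 2
                  ≤ c * C ω * ((∑ k ∈ indexShell r n m, a k ^ 2) *
                      Real.log (max (φ m) T))) := by
  -- All constants, including those depending on `d`, are already inside `C ω`.
  refine ⟨1, one_pos, ?_⟩
  intro Ω _ P _ r hr φ hφ0 hφm ⟨c₀, hc₀, hφ⟩ ν hν a ha
  simp only [one_mul]
  exact ⟨exists_ae_bound_complex hφ0 hφm hc₀ hφ hν fun k => (ha k).1,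
    exists_ae_bound_probability hr hφ0 hφm hc₀ hφ hν fun k => (ha k).1⟩
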